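/- A \emph{Smale space} $(X,\varphi)$ is a compact metric space $(X,d)$ with a homeomorphism $\varphi:X\to X$ for which there are constants $\varepsilon_X>0$, $0<\lambda<1$ and a continuous map $[\cdot,\cdot]:\{(x,y)\in X\times X: d(x,y)\le\varepsilon_X\}\to X$ with $[x,x]=x$, $[x,[y,z]]=[x,z]$, $[[x,y],z]=[x,z]$, $\varphi[x,y]=[\varphi(x),\varphi(y)]$ whenever both sides are defined, and such that $d(\varphi(x),\varphi(y))\le\lambda d(x,y)$ whenever $[x,y]=y$, and $d(\varphi^{-1}(x),\varphi^{-1}(y))\le\lambda d(x,y)$ whenever $[x,y]=x$. Put $X^s(x)=\{y: d(\varphi^n(x),\varphi^n(y))\to0 \text{ as } n\to+\infty\}$ and $X^u(x)=\{y: d(\varphi^{-n}(x),\varphi^{-n}(y))\to0\text{ as } n\to+\infty\}$. A \emph{factor map} $\pi:(Y,\psi)\to(X,\varphi)$ is a continuous surjection $\pi:Y\to X$ with $\pi\circ\psi=\varphi\circ\pi$; it is \emph{s-bijective} (respectively \emph{u-bijective}) if for every $y\in Y$ it restricts to a bijection $Y^s(y)\to X^s(\pi(y))$ (respectively $Y^u(y)\to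 X^u(\pi(y))$). A \emph{correspondence} from $(X,\varphi)$ to $(Y,\psi)$ consists of a Smale space $(M,\mu)$, a u-bijective factor map $\pi_u:(M,\mu)\to(X,\varphi)$ and an s-bijective factor map $\pi_s:(M,\mu)\to(Y,\psi)$. For a finite directed graph $G$ (loops and multiple edges allowed) in which every vertex has an incoming and an outgoing edge, let $\Sigma_G$ be the space of bi-infinite edge paths $(e^k)_{k\in\mathbb Z}$ in $G$, with the topology induced by the product of discrete topologies, and let $\sigma(e)^k=e^{k+1}$. A dynamical system is a \emph{shift of finite type} if it is topologically conjugate to some $(\Sigma_G,\sigma)$. \textbf{Lemma.} Let $(\Sigma,\sigma)$ be a Smale space which is a shift of finite type, and let $(X,\varphi)$ be a Smale space. Suppose that there exist a correspondence from $(X,\varphi)$ to $(\Sigma,\sigma)$ and a correspondence from $(\Sigma,\sigma)$ to $(X,\varphi)$. Then $(X,\varphi)$ is a shift of finite type. -/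

import Mathlib

open Filter Topology

universe u v w w₁ w₂

/-- The homeomorphism `φ` of the compact metric space `X` makes it a Smale space: there are
constants `ε > 0`, `0 < r < 1` and a bracket `b`, continuous on the pairs at distance at most `ε`,
satisfying the bracket axioms B1-B4 whenever both sides are defined and the contraction axioms
C1-C2. The values of `b` on pairs at distance more than `ε` are never used. -/
def IsSmaleSpace {X : Type*} [MetricSpace X] [CompactSpace X] (φ : X ≃ₜ X) : Prop :=
  ∃ (ε r : ℝ) (b : X → X → X), 0 < ε ∧ 0 < r ∧ r < 1 ∧
    ContinuousOn (fun p : X × X => b p.1 p.2) {p : X × X | dist p.1 p.2 ≤ ε} ∧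
    -- B1
    (∀ x, b x x = x) ∧
    -- B2
    (∀ x y z, dist y z ≤ ε → dist x (b y z) ≤ ε → dist x z ≤ ε → b x (b y z) = b x z) ∧
    -- B3
    (∀ x y z, dist x y ≤ ε → dist (b x y) z ≤ ε → dist x z ≤ ε → b (b x y) z = b x z) ∧
    -- B4
    (∀ x y, dist x y ≤ ε → dist (φ x) (φ y) ≤ ε → φ (b x y) = b (φ x) (φ y)) ∧
    -- C1
    (∀ x y, dist x y ≤ ε → b x y = y → dist (φ x) (φ y) ≤ r * dist x y) ∧
    -- C2
    (∀ x y, dist x y ≤ ε → b x y = x → dist (φ.symm x) (φ.symm y) ≤ r * dist x y)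

/-- The global stable set of `x`. -/
def stableSet {X : Type*} [MetricSpace X] (φ : X ≃ₜ X) (x : X) : Set X :=
  {y | Tendsto (fun n : ℕ => dist (φ^[n] x) (φ^[n] y)) atTop (𝓝 0)}

/-- The global unstable set of `x`. -/
def unstableSet {X : Type*} [MetricSpace X] (φ : X ≃ₜ X) (x : X) : Set X :=
  {y | Tendsto (fun n : ℕ => dist (φ.symm^[n] x) (φ.symm^[n] y)) atTop (𝓝 0)}

/-- A factor map from `(Y, ψ)` to `(X, φ)`: a continuous equivariant surjection. -/
structure IsFactorMap {Y X : Type*} [TopologicalSpace Y] [TopologicalSpace X]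
    (ψ : Y ≃ₜ Y) (φ : X ≃ₜ X) (f : Y → X) : Prop where
  continuous : Continuous f
  equivariant : ∀ y, f (ψ y) = φ (f y)
  surjective : Function.Surjective f

/-- An s-bijective factor map: each stable set is mapped bijectively onto a stable set. -/
structure IsSBijective {Y X : Type*} [MetricSpace Y] [MetricSpace X]
    (ψ : Y ≃ₜ Y) (φ : X ≃ₜ X) (f : Y → X) : Prop where
  isFactorMap : IsFactorMap ψ φ f
  bijOn : ∀ y, Set.BijOn f (stableSet ψ y) (stableSet φ (f y))

/-- A u-bijective factor map: each unstable set is mapped bijectively onto an unstable set. -/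
structure IsUBijective {Y X : Type*} [MetricSpace Y] [MetricSpace X]
    (ψ : Y ≃ₜ Y) (φ : X ≃ₜ X) (f : Y → X) : Prop where
  isFactorMap : IsFactorMap ψ φ f
  bijOn : ∀ y, Set.BijOn f (unstableSet ψ y) (unstableSet φ (f y))

/-- A correspondence from `(X, φ)` to `(Y, ψ)`: a Smale space `(M, μ)` with a u-bijective factor map
to `(X, φ)` and an s-bijective factor map to `(Y, ψ)`. -/
structure Correspondence {X : Type u} {Y : Type v} [MetricSpace X] [MetricSpace Y]
    (φ : X ≃ₜ X) (ψ : Y ≃ₜ Y) where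
  M : Type w
  [metricSpace : MetricSpace M]
  [compactSpace : CompactSpace M]
  μ : M ≃ₜ M
  isSmaleSpace : IsSmaleSpace μ
  πu : M → X
  πs : M → Y
  isUBijective : IsUBijective μ φ πu
  isSBijective : IsSBijective μ ψ πs

/-- A finite directed graph (loops and multiple edges allowed) without sources or sinks. -/
structure FiniteGraph where
  Vertex : Type
  Edge : Type
  [finiteVertex : Finite Vertex]
  [finiteEdge : Finite Edge]
  i : Edge → Vertex
  t : Edge → Vertex
  no_source : ∀ v, ∃ e, t e = v
  no_sink : ∀ v, ∃ e, i e = v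

namespace FiniteGraph

instance (G : FiniteGraph) : TopologicalSpace G.Edge := ⊥

instance (G : FiniteGraph) : DiscreteTopology G.Edge := ⟨rfl⟩

/-- The space of bi-infinite edge paths of `G`, as a subspace of the product of the discrete
space of edges over `ℤ`. -/
abbrev PathSpace (G : FiniteGraph) : Type :=
  {e : ℤ → G.Edge // ∀ k, G.t (e k) = G.i (e (k + 1))}

/-- The shift map on the path space of `G`. -/
def shift (G : FiniteGraph) : G.PathSpace ≃ₜ G.PathSpace where
  toFun e := ⟨fun k => e.1 (k + 1), fun k => e.2 (k + 1)⟩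
  invFun e := ⟨fun k => e.1 (k - 1), fun k => by
    have h := e.2 (k - 1)
    rwa [show k - 1 + 1 = k + 1 - 1 by ring] at h⟩
  left_inv e := by ext k; simp
  right_inv e := by ext k; simp
  continuous_toFun := by
    refine Continuous.subtype_mk (continuous_pi fun k => ?_) _
    exact (continuous_apply (k + 1)).comp continuous_subtype_val
  continuous_invFun := by
    refine Continuous.subtype_mk (continuous_pi fun k => ?_) _
    exact (continuous_apply (k - 1)).comp continuous_subtype_val

end FiniteGraph

/-- `(X, φ)` is (conjugate to) a shift of finite type. -/
def IsShiftOfFiniteType {X : Type*} [TopologicalSpace X] (φ : X ≃ₜ X) : Prop :=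
  ∃ (G : FiniteGraph) (h : X ≃ₜ G.PathSpace), ∀ x, h (φ x) = G.shift (h x)

/-!
Since a shift of finite type is totally disconnected, the point is to transport total
disconnectedness from `S` to `X` through the two correspondences, and then to show that a totally
disconnected Smale space is a shift of finite type.

Let `M` be the Smale space of the correspondence from `X` to `S`. A connected subset of `M` is
mapped by `πs` to a point of `S`. An s-bijective map has finite fibres
(`IsSBijective.finite_fiber`): two nearby points of a fibre are unstably equivalent, since their
bracket is stably equivalent to the first one and has the same image, so that orbits of distinct
points of the fibre are separated by a uniform distance at all large times, and compactness of `M`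
bounds their number. Hence `M` is totally disconnected
(`IsSBijective.totallyDisconnectedSpace`), and so is, by time reversal, the Smale space `N` of the
correspondence from `S` to `X`.

Now `N` is mapped to `X` by an s-bijective map. A stable set of `N` is a countable union of compact
sets, each of which is mapped homeomorphically onto its image in a stable set of `X`; by Baire's
theorem the stable sets of `X` contain no nontrivial continuum
(`IsSBijective.subsingleton_of_subset_stableSet`). In this way neither openness nor properness of
resolving maps on stable sets is needed. Likewise `M` shows that the unstable sets of `X` contain no
nontrivial continuum. As `X` is locally a product of stable and unstable sets, it is totally
disconnected (`IsSmaleSpace.totallyDisconnectedSpace`).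

Finally, code a totally disconnected Smale space by a fine partition into clopen sets. The coding is
injective by expansiveness. If two itineraries agree on a long window, then the points at the middle
of the window are close, and the orbit of their bracket has the future of one and the past of the
other itinerary. Therefore the set of itineraries is determined by the words of a fixed length which
occur in it, and `X` is conjugate to the shift on the graph of these words
(`isShiftOfFiniteType_of_splice`, `IsSmaleSpace.isShiftOfFiniteType`).
-/

/-! ### The bracket of a Smale space -/

/-- The bracket `b`, with constants `ε` and `r`, makes `φ` a Smale space. The bracket is a total
function, about which nothing is assumed on pairs at distance more than `ε`. -/
structure IsSmaleBracket {X : Type*} [MetricSpace X] (φ : X ≃ₜ X) (ε r : ℝ) (b : X → X → X) :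
    Prop where
  eps_pos : 0 < ε
  r_pos : 0 < r
  r_lt_one : r < 1
  continuousOn : ContinuousOn (fun p : X × X => b p.1 p.2) {p : X × X | dist p.1 p.2 ≤ ε}
  self : ∀ x, b x x = x
  right : ∀ x y z, dist y z ≤ ε → dist x (b y z) ≤ ε → dist x z ≤ ε → b x (b y z) = b x z
  left : ∀ x y z, dist x y ≤ ε → dist (b x y) z ≤ ε → dist x z ≤ ε → b (b x y) z = b x z
  map : ∀ x y, dist x y ≤ ε → dist (φ x) (φ y) ≤ ε → φ (b x y) = b (φ x) (φ y)
  contract : ∀ x y, dist x y ≤ ε → b x y = y → dist (φ x) (φ y) ≤ r * dist x y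
  contract_symm : ∀ x y, dist x y ≤ ε → b x y = x → dist (φ.symm x) (φ.symm y) ≤ r * dist x y

theorem IsSmaleSpace.exists_isSmaleBracket {X : Type*} [MetricSpace X] [CompactSpace X]
    {φ : X ≃ₜ X} (h : IsSmaleSpace φ) : ∃ ε r b, IsSmaleBracket φ ε r b := by
  obtain ⟨ε, r, b, h1, h2, h3, h4, h5, h6, h7, h8, h9, h10⟩ := h
  exact ⟨ε, r, b, h1, h2, h3, h4, h5, h6, h7, h8, h9, h10⟩

namespace IsSmaleBracket

variable {X : Type*} [MetricSpace X] {φ : X ≃ₜ X} {ε r : ℝ} {b : X → X → X}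

/-- Reversing time and the arguments of the bracket exchanges stable and unstable sets, so that
each statement about stable sets has an unstable counterpart. -/
theorem symm (h : IsSmaleBracket φ ε r b) : IsSmaleBracket φ.symm ε r (fun x y => b y x) where
  eps_pos := h.eps_pos
  r_pos := h.r_pos
  r_lt_one := h.r_lt_one
  continuousOn := by
    refine h.continuousOn.comp (f := Prod.swap) continuous_swap.continuousOn ?_
    intro p hp
    simpa [dist_comm] using hp
  self := h.self
  right x y z h1 h2 h3 := h.left z y x (by rwa [dist_comm]) (by rwa [dist_comm])
    (by rwa [dist_comm])
  left x y z h1 h2 h3 := h.right z y x (by rwa [dist_comm]) (by rwa [dist_comm])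
    (by rwa [dist_comm])
  map x y h1 h2 := by
    rw [Homeomorph.symm_apply_eq, h.map _ _ (by rwa [dist_comm])] <;>
      simp [dist_comm, h1]
  contract x y h1 h2 := by
    simpa [dist_comm] using h.contract_symm y x (by rwa [dist_comm]) h2
  contract_symm x y h1 h2 := by
    simpa [dist_comm] using h.contract y x (by rwa [dist_comm]) h2

theorem iterate_of_eq_right (h : IsSmaleBracket φ ε r b) {x y : X} (hd : dist x y ≤ ε)
    (hb : b x y = y) (n : ℕ) :
    dist (φ^[n] x) (φ^[n] y) ≤ r ^ n * dist x y ∧ b (φ^[n] x) (φ^[n] y) = φ^[n] y := by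
  induction n with
  | zero => simpa using hb
  | succ n ih =>
    have hle : dist (φ^[n] x) (φ^[n] y) ≤ ε := ih.1.trans <|
      (mul_le_of_le_one_left dist_nonneg (pow_le_one₀ h.r_pos.le h.r_lt_one.le)).trans hd
    have h1 := h.contract _ _ hle ih.2
    have hle' : dist (φ (φ^[n] x)) (φ (φ^[n] y)) ≤ ε := h1.trans <|
      (mul_le_of_le_one_left dist_nonneg h.r_lt_one.le).trans hle
    simp only [Function.iterate_succ_apply']
    refine ⟨h1.trans ?_, ?_⟩
    · rw [pow_succ', mul_assoc]
      exact mul_le_mul_of_nonneg_left ih.1 h.r_pos.le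
    · rw [← h.map _ _ hle hle', ih.2]

theorem mem_stableSet_of_eq_right (h : IsSmaleBracket φ ε r b) {x y : X} (hd : dist x y ≤ ε)
    (hb : b x y = y) : y ∈ stableSet φ x := by
  refine squeeze_zero (fun _ => dist_nonneg) (fun n => (h.iterate_of_eq_right hd hb n).1) ?_
  simpa using (tendsto_pow_atTop_nhds_zero_of_lt_one h.r_pos.le h.r_lt_one).mul_const (dist x y)

theorem bracket_bracket_right (h : IsSmaleBracket φ ε r b) {x y : X} (hd : dist x y ≤ ε)
    (hx : dist x (b x y) ≤ ε) : b x (b x y) = b x y :=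
  h.right x x y hd hx hd

variable [CompactSpace X]

theorem exists_dist_le (h : IsSmaleBracket φ ε r b) {η : ℝ} (hη : 0 < η) :
    ∃ δ, 0 < δ ∧ δ ≤ ε ∧ ∀ x y, dist x y ≤ δ → dist x (b x y) ≤ η ∧ dist y (b x y) ≤ η := by
  let D := {p : X × X | dist p.1 p.2 ≤ ε}
  have hD : IsClosed D := isClosed_le (by fun_prop) continuous_const
  let f : X × X → ℝ := fun p => max (dist p.1 (b p.1 p.2)) (dist p.2 (b p.1 p.2))
  have hf : ContinuousOn f D :=
    (continuous_dist.comp_continuousOn (continuous_fst.continuousOn.prodMk h.continuousOn)).sup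
      (continuous_dist.comp_continuousOn (continuous_snd.continuousOn.prodMk h.continuousOn))
  have hT : IsClosed (D ∩ f ⁻¹' Set.Ici η) := hf.preimage_isClosed_of_isClosed hD isClosed_Ici
  rcases (D ∩ f ⁻¹' Set.Ici η).eq_empty_or_nonempty with he | hne
  · refine ⟨ε, h.eps_pos, le_rfl, fun x y hxy => ?_⟩
    have : (x, y) ∉ D ∩ f ⁻¹' Set.Ici η := by simp [he]
    have h2 : f (x, y) < η := by
      by_contra hc
      exact this ⟨hxy, not_lt.1 hc⟩
    exact ⟨(le_max_left _ _).trans h2.le, (le_max_right _ _).trans h2.le⟩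
  · obtain ⟨p, hp, hmin⟩ := hT.isCompact.exists_isMinOn hne
      (f := fun p : X × X => dist p.1 p.2) (by fun_prop)
    have hpos : 0 < dist p.1 p.2 := by
      refine dist_pos.2 fun heq => ?_
      have h1 : η ≤ f p := hp.2
      simp only [f, ← heq, h.self, dist_self, max_self] at h1
      linarith
    refine ⟨min ε (dist p.1 p.2 / 2), lt_min h.eps_pos (by linarith), min_le_left _ _,
      fun x y hxy => ?_⟩
    have h2 : f (x, y) < η := by
      by_contra hc
      have h3 : dist p.1 p.2 ≤ dist x y :=
        hmin (show (x, y) ∈ _ from ⟨hxy.trans (min_le_left _ _), not_lt.1 hc⟩)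
      have h4 := hxy.trans (min_le_right _ _)
      linarith
    exact ⟨(le_max_left _ _).trans h2.le, (le_max_right _ _).trans h2.le⟩

theorem exists_iterate_dist_le (h : IsSmaleBracket φ ε r b) {η : ℝ} (hη : 0 < η) :
    ∃ δ, 0 < δ ∧ δ ≤ ε ∧ ∀ x y, dist x y ≤ δ →
      b x y ∈ stableSet φ x ∧ b x y ∈ unstableSet φ y ∧
      (∀ n, dist (φ^[n] x) (φ^[n] (b x y)) ≤ η) ∧
      ∀ n, dist (φ.symm^[n] y) (φ.symm^[n] (b x y)) ≤ η := by
  -- The stable half, phrased so that time reversal applies to it.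
  have key : ∀ (ψ : X ≃ₜ X) (c : X → X → X) (x y : X), IsSmaleBracket ψ ε r c → dist x y ≤ ε →
      dist x (c x y) ≤ min η ε →
      c x y ∈ stableSet ψ x ∧ ∀ n, dist (ψ^[n] x) (ψ^[n] (c x y)) ≤ η := by
    intro ψ c x y hc hd hx
    have hb := hc.bracket_bracket_right hd (hx.trans (min_le_right _ _))
    refine ⟨hc.mem_stableSet_of_eq_right (hx.trans (min_le_right _ _)) hb, fun n => ?_⟩
    refine (hc.iterate_of_eq_right (hx.trans (min_le_right _ _)) hb n).1.trans ?_
    exact (mul_le_of_le_one_left dist_nonneg (pow_le_one₀ hc.r_pos.le hc.r_lt_one.le)).trans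
      (hx.trans (min_le_left _ _))
  obtain ⟨δ, hδ, hδε, H⟩ := h.exists_dist_le (lt_min hη h.eps_pos)
  refine ⟨δ, hδ, hδε, fun x y hxy => ?_⟩
  have h1 := key φ b x y h (hxy.trans hδε) (H x y hxy).1
  have h2 := key φ.symm _ y x h.symm (by rw [dist_comm]; exact hxy.trans hδε) (H x y hxy).2
  exact ⟨h1.1, h2.1, h1.2, h2.2⟩

/-- If the forward orbits of `x` and `y` stay close, then `y` is on the local stable set of `x`:
`b x y` and `y` are on the same local unstable set, and their forward orbits stay close, so
contracting `n` steps backwards shows that they agree. -/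
theorem exists_forall_bracket_eq (h : IsSmaleBracket φ ε r b) :
    ∃ δ, 0 < δ ∧ δ ≤ ε ∧ ∀ x y, (∀ n, dist (φ^[n] x) (φ^[n] y) ≤ δ) → b x y = y := by
  obtain ⟨δ, hδ, hδε, H⟩ := h.exists_dist_le h.eps_pos
  refine ⟨δ, hδ, hδε, fun x y hxy => ?_⟩
  have hmap : ∀ n, φ^[n] (b x y) = b (φ^[n] x) (φ^[n] y) := by
    intro n
    induction n with
    | zero => rfl
    | succ n ih =>
      have := hxy (n + 1)
      simp only [Function.iterate_succ_apply'] at this ⊢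
      rw [ih, h.map _ _ ((hxy n).trans hδε) (this.trans hδε)]
  have hle : ∀ n, dist (b x y) y ≤ r ^ n * ε := by
    intro n
    have h1 := (H _ _ (hxy n)).2
    rw [← hmap] at h1
    have h2 : b (φ^[n] (b x y)) (φ^[n] y) = φ^[n] (b x y) := by
      rw [hmap]
      refine h.left _ _ _ ((hxy n).trans hδε) ?_ ((hxy n).trans hδε)
      rw [dist_comm, ← hmap]
      exact h1
    have h3 := (h.symm.iterate_of_eq_right h1 h2 n).1
    have hinv : ∀ z, φ.symm^[n] (φ^[n] z) = z :=
      Function.LeftInverse.iterate φ.symm_apply_apply n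
    rw [hinv, hinv, dist_comm] at h3
    exact h3.trans (mul_le_mul_of_nonneg_left h1 (pow_nonneg h.r_pos.le n))
  have hlim : Tendsto (fun n : ℕ => r ^ n * ε) atTop (𝓝 0) := by
    simpa using (tendsto_pow_atTop_nhds_zero_of_lt_one h.r_pos.le h.r_lt_one).mul_const ε
  exact dist_le_zero.1 (ge_of_tendsto' hlim hle)

end IsSmaleBracket

namespace IsSmaleSpace

variable {X : Type*} [MetricSpace X] [CompactSpace X] {φ : X ≃ₜ X}

theorem symm (h : IsSmaleSpace φ) : IsSmaleSpace φ.symm := by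
  obtain ⟨ε, r, b, hb⟩ := h.exists_isSmaleBracket
  have := hb.symm
  exact ⟨ε, r, fun x y => b y x, this.1, this.2, this.3, this.4, this.5, this.6, this.7, this.8,
    this.9, this.10⟩

theorem exists_forall_mem_stableSet (h : IsSmaleSpace φ) :
    ∃ c, 0 < c ∧ ∀ x y, (∀ n, dist (φ^[n] x) (φ^[n] y) ≤ c) → y ∈ stableSet φ x := by
  obtain ⟨ε, r, b, hb⟩ := h.exists_isSmaleBracket
  obtain ⟨δ, hδ, hδε, H⟩ := hb.exists_forall_bracket_eq
  exact ⟨δ, hδ, fun x y hxy => hb.mem_stableSet_of_eq_right ((hxy 0).trans hδε) (H x y hxy)⟩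

/-- Smale spaces are expansive. -/
theorem exists_expansive (h : IsSmaleSpace φ) :
    ∃ c, 0 < c ∧ ∀ x y, (∀ n, dist (φ^[n] x) (φ^[n] y) ≤ c) →
      (∀ n, dist (φ.symm^[n] x) (φ.symm^[n] y) ≤ c) → x = y := by
  obtain ⟨ε, r, b, hb⟩ := h.exists_isSmaleBracket
  obtain ⟨δ, hδ, hδε, H⟩ := hb.exists_forall_bracket_eq
  obtain ⟨δ', hδ', hδε', H'⟩ := hb.symm.exists_forall_bracket_eq
  refine ⟨min δ δ', lt_min hδ hδ', fun x y h1 h2 => ?_⟩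
  rw [← H x y fun n => (h1 n).trans (min_le_left _ _)]
  refine (H' y x fun n => ?_).symm
  rw [dist_comm]
  exact (h2 n).trans (min_le_right _ _)

/-- Two nearby points have a bracket, whose forward orbit follows that of the first point and whose
backward orbit follows that of the second. -/
theorem exists_splice (h : IsSmaleSpace φ) {η : ℝ} (hη : 0 < η) :
    ∃ δ, 0 < δ ∧ ∀ x y, dist x y ≤ δ → ∃ z,
      z ∈ stableSet φ x ∧ z ∈ unstableSet φ y ∧
      (∀ n, dist (φ^[n] x) (φ^[n] z) ≤ η) ∧ ∀ n, dist (φ.symm^[n] y) (φ.symm^[n] z) ≤ η := by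
  obtain ⟨ε, r, b, hb⟩ := h.exists_isSmaleBracket
  obtain ⟨δ, hδ, -, H⟩ := hb.exists_iterate_dist_le hη
  exact ⟨δ, hδ, fun x y hxy => ⟨b x y, H x y hxy⟩⟩

/-- The local product structure: near each point `x` there are continuous projections to the stable
and the unstable set of `x` which jointly separate points. -/
theorem exists_local_coordinates (h : IsSmaleSpace φ) :
    ∃ δ, 0 < δ ∧ ∀ x, ∃ p q : X → X, ContinuousOn p (Metric.closedBall x δ) ∧
      ContinuousOn q (Metric.closedBall x δ) ∧
      Set.MapsTo p (Metric.closedBall x δ) (stableSet φ x) ∧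
      Set.MapsTo q (Metric.closedBall x δ) (unstableSet φ x) ∧
      ∀ y ∈ Metric.closedBall x δ, ∀ z ∈ Metric.closedBall x δ, p y = p z → q y = q z → y = z := by
  obtain ⟨ε, r, b, hb⟩ := h.exists_isSmaleBracket
  obtain ⟨δ₁, hδ₁, hδε₁, H₁⟩ := hb.exists_iterate_dist_le hb.eps_pos
  obtain ⟨δ₂, hδ₂, -, H₂⟩ := hb.exists_dist_le (half_pos hb.eps_pos)
  have hsub : ∀ x y : X, y ∈ Metric.closedBall x (min δ₁ δ₂) →
      dist x y ≤ δ₁ ∧ dist y x ≤ δ₁ ∧ dist x y ≤ δ₂ ∧ dist y x ≤ δ₂ := by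
    intro x y hy
    rw [Metric.mem_closedBall] at hy
    have h1 := hy.trans (min_le_left _ _)
    have h2 := hy.trans (min_le_right _ _)
    exact ⟨by rwa [dist_comm], h1, by rwa [dist_comm], h2⟩
  refine ⟨min δ₁ δ₂, lt_min hδ₁ hδ₂, fun x => ⟨fun y => b x y, fun y => b y x, ?_, ?_, ?_, ?_, ?_⟩⟩
  · exact hb.continuousOn.comp (f := fun y : X => (x, y)) (Continuous.continuousOn (by fun_prop))
      fun y hy => (hsub x y hy).1.trans hδε₁
  · exact hb.continuousOn.comp (f := fun y : X => (y, x)) (Continuous.continuousOn (by fun_prop))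
      fun y hy => (hsub x y hy).2.1.trans hδε₁
  · exact fun y hy => (H₁ x y (hsub x y hy).1).1
  · exact fun y hy => (H₁ y x (hsub x y hy).2.1).2.1
  · have hrec : ∀ y ∈ Metric.closedBall x (min δ₁ δ₂), b (b y x) (b x y) = y := by
      intro y hy
      obtain ⟨h1, h2, h3, h4⟩ := hsub x y hy
      have h5 := (H₂ x y h3).2
      have h6 := (H₂ y x h4).1
      have hε := hb.eps_pos
      have h7 : dist (b y x) (b x y) ≤ ε :=
        (dist_triangle_left (b y x) (b x y) y).trans (by linarith)
      rw [hb.left y x (b x y) (h2.trans hδε₁) h7 (by linarith),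
        hb.right y x y (h1.trans hδε₁) (by linarith) (by simpa using hε.le), hb.self]
    intro y hy z hz hp hq
    rw [← hrec y hy, ← hrec z hz]
    exact congrArg₂ b hq hp

end IsSmaleSpace

/-! ### Totally disconnected spaces -/

theorem IsCompact.exists_isClopen_of_isTotallyDisconnected {Z : Type*} [TopologicalSpace Z]
    [T2Space Z] {F : Set Z} (hF : IsCompact F) (hd : IsTotallyDisconnected F) {x : Z}
    (hx : x ∈ interior F) : ∃ V, IsClopen V ∧ x ∈ V ∧ V ⊆ F := by
  have := isCompact_iff_compactSpace.1 hF
  have : TotallyDisconnectedSpace F := totallyDisconnectedSpace_subtype_iff.2 hd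
  obtain ⟨V, hV, hxV, hVF⟩ := compact_exists_isClopen_in_isOpen
    (x := (⟨x, interior_subset hx⟩ : F)) (isOpen_interior.preimage continuous_subtype_val) hx
  refine ⟨(↑) '' V, ⟨hF.isClosed.isClosedEmbedding_subtypeVal.isClosedMap _ hV.1, ?_⟩,
    ⟨_, hxV, rfl⟩, by simp⟩
  obtain ⟨O, hO, rfl⟩ := isOpen_induced_iff.1 hV.2
  have : ((↑) '' ((↑) ⁻¹' O : Set F) : Set Z) = O ∩ interior F := by
    ext z
    constructor
    · rintro ⟨y, hy, rfl⟩
      exact ⟨hy, hVF hy⟩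
    · rintro ⟨h1, h2⟩
      exact ⟨⟨z, interior_subset h2⟩, h1, rfl⟩
  rw [this]
  exact hO.inter isOpen_interior

/-- A connected compact set covered by countably many compact totally disconnected sets is at most
a point: by Baire one of them has interior in it, hence contains a clopen subset of it. -/
theorem IsPreconnected.subsingleton_of_subset_iUnion {Z : Type*} [TopologicalSpace Z] [T2Space Z]
    {C : Set Z} (hC : IsPreconnected C) (hCc : IsCompact C) {F : ℕ → Set Z}
    (hF : ∀ k, IsCompact (F k)) (hd : ∀ k, IsTotallyDisconnected (F k)) (hCF : C ⊆ ⋃ k, F k) :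
    C.Subsingleton := by
  rcases C.eq_empty_or_nonempty with rfl | hne
  · exact Set.subsingleton_empty
  have := hne.to_subtype
  have := isCompact_iff_compactSpace.1 hCc
  have := Subtype.preconnectedSpace hC
  obtain ⟨k, x, hx⟩ := nonempty_interior_of_iUnion_of_closed
    (f := fun k => ((↑) ⁻¹' F k : Set C)) (fun k => (hF k).isClosed.preimage continuous_subtype_val)
    (by
      rw [← Set.preimage_iUnion]
      exact Set.eq_univ_of_forall fun y => hCF y.2)
  have hk : IsCompact ((↑) ⁻¹' F k : Set C) :=
    ((hF k).isClosed.preimage continuous_subtype_val).isCompact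
  have hdk : IsTotallyDisconnected ((↑) ⁻¹' F k : Set C) := by
    intro t ht htc
    have := hd k _ (Set.image_subset_iff.2 ht) (htc.image _ continuous_subtype_val.continuousOn)
    exact Set.subsingleton_of_image Subtype.val_injective t this
  obtain ⟨V, hV, hxV, hVF⟩ := hk.exists_isClopen_of_isTotallyDisconnected hdk hx
  have hCk : C ⊆ F k := by
    intro y hy
    have : (⟨y, hy⟩ : C) ∈ V := by rw [hV.eq_univ ⟨x, hxV⟩]; trivial
    exact hVF this
  exact hd k C hCk hC

theorem totallyDisconnectedSpace_of_closedBall {X : Type*} [MetricSpace X] [CompactSpace X] {δ : ℝ}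
    (hδ : 0 < δ) (h : ∀ x : X, IsTotallyDisconnected (Metric.closedBall x δ)) :
    TotallyDisconnectedSpace X := by
  refine ⟨fun C _ hC => ?_⟩
  rcases C.eq_empty_or_nonempty with rfl | ⟨x, hx⟩
  · exact Set.subsingleton_empty
  obtain ⟨V, hV, hxV, hVB⟩ :=
    Metric.isClosed_closedBall.isCompact.exists_isClopen_of_isTotallyDisconnected (h x)
      (mem_interior_iff_mem_nhds.2 (Metric.closedBall_mem_nhds x hδ))
  exact h x C ((hC.subset_isClopen hV ⟨x, hx, hxV⟩).trans hVB) hC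

/-! ### Resolving maps -/

theorem IsFactorMap.iterate {Y X : Type*} [TopologicalSpace Y] [TopologicalSpace X]
    {ψ : Y ≃ₜ Y} {φ : X ≃ₜ X} {f : Y → X} (h : IsFactorMap ψ φ f) (n : ℕ) (y : Y) :
    f (ψ^[n] y) = φ^[n] (f y) :=
  Function.Semiconj.iterate_right (f := f) h.equivariant n y

theorem IsFactorMap.symm {Y X : Type*} [TopologicalSpace Y] [TopologicalSpace X]
    {ψ : Y ≃ₜ Y} {φ : X ≃ₜ X} {f : Y → X} (h : IsFactorMap ψ φ f) :
    IsFactorMap ψ.symm φ.symm f where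
  continuous := h.continuous
  equivariant y := by
    rw [Homeomorph.eq_symm_apply, ← h.equivariant, Homeomorph.apply_symm_apply]
  surjective := h.surjective

theorem IsUBijective.symm {Y X : Type*} [MetricSpace Y] [MetricSpace X]
    {ψ : Y ≃ₜ Y} {φ : X ≃ₜ X} {f : Y → X} (h : IsUBijective ψ φ f) :
    IsSBijective ψ.symm φ.symm f :=
  ⟨h.isFactorMap.symm, h.bijOn⟩

section
variable {M S : Type*} [MetricSpace M] [CompactSpace M] [MetricSpace S]
  {μ : M ≃ₜ M} {σ : S ≃ₜ S} {f : M → S}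

/-- Nearby points of a fibre of an s-bijective map have nearby backward orbits. Indeed the bracket
of the two points is mapped to the same point, by expansiveness of the target, and it is stably
equivalent to the first point, so that it is the first point. -/
theorem IsSBijective.exists_symm_iterate_dist_le [CompactSpace S] (h : IsSBijective μ σ f)
    (hμ : IsSmaleSpace μ) (hσ : IsSmaleSpace σ) {η : ℝ} (hη : 0 < η) :
    ∃ δ, 0 < δ ∧ ∀ x y, f x = f y → dist x y ≤ δ →
      ∀ n, dist (μ.symm^[n] x) (μ.symm^[n] y) ≤ η := by
  obtain ⟨c, hc, hexp⟩ := hσ.exists_expansive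
  obtain ⟨ρ, hρ, hf⟩ := Metric.uniformContinuous_iff.1
    (CompactSpace.uniformContinuous_of_continuous h.isFactorMap.continuous) c hc
  obtain ⟨δ, hδ, H⟩ := hμ.exists_splice (lt_min hη (half_pos hρ))
  refine ⟨δ, hδ, fun x y hxy hd n => ?_⟩
  obtain ⟨z, hzs, -, h1, h2⟩ := H x y hd
  have hclose : ∀ p q : M, dist p q ≤ min η (ρ / 2) → dist (f p) (f q) ≤ c := fun p q hpq =>
    (hf ((hpq.trans (min_le_right _ _)).trans_lt (half_lt_self hρ))).le
  have hfz : f x = f z := by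
    refine hexp _ _ (fun n => ?_) (fun n => ?_)
    · rw [← h.isFactorMap.iterate, ← h.isFactorMap.iterate]
      exact hclose _ _ (h1 n)
    · rw [hxy, ← h.isFactorMap.symm.iterate, ← h.isFactorMap.symm.iterate]
      exact hclose _ _ (h2 n)
  have hxs : x ∈ stableSet μ x := by simp [stableSet]
  obtain rfl : x = z := (h.bijOn x).injOn hxs hzs hfz
  rw [dist_comm]
  exact (h2 n).trans (min_le_left _ _)

/-- Distinct points of a fibre are eventually separated by a uniform distance, so that a fibre is
no larger than a finite cover of the space by sets of smaller diameter. -/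
theorem IsSBijective.finite_fiber [CompactSpace S] (h : IsSBijective μ σ f)
    (hμ : IsSmaleSpace μ) (hσ : IsSmaleSpace σ) (s : S) : (f ⁻¹' {s}).Finite := by
  obtain ⟨c, hc, hexp⟩ := hμ.exists_expansive
  obtain ⟨δ, hδ, H⟩ := h.exists_symm_iterate_dist_le hμ hσ hc
  have hsep : ∀ x ∈ f ⁻¹' {s}, ∀ y ∈ f ⁻¹' {s}, x ≠ y →
      ∀ᶠ k : ℕ in atTop, δ < dist (μ^[k] x) (μ^[k] y) := by
    intro x hx y hy hne
    by_contra hcon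
    rw [not_eventually] at hcon
    have hxy : f x = f y := hx.trans hy.symm
    -- For every `k` there is a later time at which the orbits are close.
    have hclose : ∀ k : ℕ, ∃ l, k ≤ l ∧
        ∀ n, dist (μ.symm^[n] (μ^[l] x)) (μ.symm^[n] (μ^[l] y)) ≤ c := by
      intro k
      obtain ⟨l, hl, hd⟩ := frequently_atTop.1 hcon k
      exact ⟨l, hl, H _ _ (by rw [h.isFactorMap.iterate, h.isFactorMap.iterate, hxy])
        (not_lt.1 hd)⟩
    refine hne (hexp x y (fun k => ?_) (fun k => ?_))
    · obtain ⟨l, hl, hd⟩ := hclose k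
      have hback : ∀ z, μ.symm^[l - k] (μ^[l] z) = μ^[k] z := by
        intro z
        obtain ⟨m, rfl⟩ := Nat.exists_eq_add_of_le' hl
        rw [Nat.add_sub_cancel, Function.iterate_add_apply]
        exact Function.LeftInverse.iterate μ.symm_apply_apply m _
      simpa only [hback] using hd (l - k)
    · obtain ⟨l, hl, hd⟩ := hclose 0
      have hback : ∀ z, μ.symm^[k + l] (μ^[l] z) = μ.symm^[k] z := by
        intro z
        rw [Function.iterate_add_apply]
        exact congrArg _ (Function.LeftInverse.iterate μ.symm_apply_apply l z)
      simpa only [hback] using hd (k + l)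
  by_contra hinf
  obtain ⟨t, htf, hcov⟩ := Metric.totallyBounded_iff.1
    (isCompact_univ (X := M)).totallyBounded (δ / 2) (half_pos hδ)
  obtain ⟨A, hA, hcard⟩ := Set.Infinite.exists_subset_card_eq hinf (htf.toFinset.card + 1)
  have hev : ∀ᶠ k : ℕ in atTop, ∀ x ∈ A, ∀ y ∈ A, x ≠ y → δ < dist (μ^[k] x) (μ^[k] y) := by
    rw [eventually_all_finset]
    intro x hx
    rw [eventually_all_finset]
    intro y hy
    rcases eq_or_ne x y with rfl | hne
    · simp
    · exact (hsep x (hA hx) y (hA hy) hne).mono fun k hk _ => hk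
  obtain ⟨k, hk⟩ := hev.exists
  have hcov' : ∀ x : M, ∃ p ∈ t, dist (μ^[k] x) p < δ / 2 := by
    intro x
    simpa using hcov (Set.mem_univ (μ^[k] x))
  choose g hgt hg using hcov'
  obtain ⟨x, hx, y, hy, hne, hxy⟩ := Finset.exists_ne_map_eq_of_card_lt_of_maps_to
    (s := A) (t := htf.toFinset) (f := g) (by omega) (fun x _ => by simpa using hgt x)
  have h1 := hk x hx y hy hne
  have h2 := dist_triangle_right (μ^[k] x) (μ^[k] y) (g x)
  have h3 := hg x
  have h4 := hg y
  rw [← hxy] at h4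
  linarith

theorem IsSBijective.totallyDisconnectedSpace [CompactSpace S] [TotallyDisconnectedSpace S]
    (h : IsSBijective μ σ f) (hμ : IsSmaleSpace μ) (hσ : IsSmaleSpace σ) :
    TotallyDisconnectedSpace M := by
  refine ⟨fun C _ hC => ?_⟩
  have himg := (hC.image f h.isFactorMap.continuous.continuousOn).subsingleton
  by_contra hnt
  rw [Set.not_subsingleton_iff] at hnt
  obtain ⟨x, hx⟩ := hnt.nonempty
  refine hC.infinite_of_nontrivial hnt ((h.finite_fiber hμ hσ (f x)).subset fun y hy => ?_)
  exact himg ⟨y, hy, rfl⟩ ⟨x, hx, rfl⟩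

/-- An s-bijective map with totally disconnected source forces the stable sets of the target to be
totally disconnected: they are covered by injective images of countably many compact subsets of the
stable sets of the source. -/
theorem IsSBijective.subsingleton_of_subset_stableSet [TotallyDisconnectedSpace M]
    (h : IsSBijective μ σ f) (hμ : IsSmaleSpace μ) {x : S} {C : Set S} (hC : IsPreconnected C)
    (hCc : IsCompact C) (hCx : C ⊆ stableSet σ x) : C.Subsingleton := by
  obtain ⟨m, rfl⟩ := h.isFactorMap.surjective x
  obtain ⟨c, hc, hst⟩ := hμ.exists_forall_mem_stableSet
  -- The points of the stable set of `m` whose orbits are close to that of `m` from time `k` on.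
  let K : ℕ → Set M := fun k => {y | ∀ j, dist (μ^[j + k] m) (μ^[j + k] y) ≤ c}
  have hKc : ∀ k, IsCompact (K k) := by
    intro k
    refine IsClosed.isCompact ?_
    simp only [K, Set.ofPred_forall]
    exact isClosed_iInter fun j =>
      isClosed_le (continuous_const.dist (μ.continuous.iterate _)) continuous_const
  have hKs : ∀ k, K k ⊆ stableSet μ m := by
    intro k y hy
    have h1 := hst (μ^[k] m) (μ^[k] y) fun n => by
      rw [← Function.iterate_add_apply, ← Function.iterate_add_apply]
      exact hy n
    simp only [stableSet, Set.mem_ofPred_eq, ← Function.iterate_add_apply] at h1 ⊢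
    exact (tendsto_add_atTop_iff_nat (f := fun n => dist (μ^[n] m) (μ^[n] y)) k).1 h1
  refine hC.subsingleton_of_subset_iUnion hCc (F := fun k => f '' K k)
    (fun k => (hKc k).image h.isFactorMap.continuous) (fun k => ?_) ?_
  · have := isCompact_iff_compactSpace.1 (hKc k)
    have hemb : Topology.IsClosedEmbedding ((K k).domRestrict f) :=
      (h.isFactorMap.continuous.comp continuous_subtype_val).isClosedEmbedding
        (((h.bijOn m).injOn.mono (hKs k)).injective)
    rw [← Set.range_domRestrict, hemb.isEmbedding.isTotallyDisconnected_range]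
    infer_instance
  · intro s hs
    obtain ⟨y, hy, rfl⟩ := (h.bijOn m).surjOn (hCx hs)
    obtain ⟨k, hk⟩ := eventually_atTop.1 (Tendsto.eventually_le_const hc hy)
    exact Set.mem_iUnion.2 ⟨k, y, fun j => hk _ (Nat.le_add_left _ _), rfl⟩

end

/-- A Smale space whose stable and unstable sets contain no nontrivial continua is totally
disconnected, by the local product structure. -/
theorem IsSmaleSpace.totallyDisconnectedSpace {X : Type*} [MetricSpace X] [CompactSpace X]
    {φ : X ≃ₜ X} (h : IsSmaleSpace φ)
    (hs : ∀ (x : X) (C : Set X), IsPreconnected C → IsCompact C → C ⊆ stableSet φ x →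
      C.Subsingleton)
    (hu : ∀ (x : X) (C : Set X), IsPreconnected C → IsCompact C → C ⊆ unstableSet φ x →
      C.Subsingleton) : TotallyDisconnectedSpace X := by
  obtain ⟨δ, hδ, H⟩ := h.exists_local_coordinates
  refine totallyDisconnectedSpace_of_closedBall hδ fun x C hCB hC => ?_
  obtain ⟨p, q, hp, hq, hps, hqu, hpq⟩ := H x
  have hsub : closure C ⊆ Metric.closedBall x δ := closure_minimal hCB Metric.isClosed_closedBall
  have hcc : IsCompact (closure C) := isClosed_closure.isCompact
  have h1 := hs x (p '' closure C) (hC.closure.image p (hp.mono hsub))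
    (hcc.image_of_continuousOn (hp.mono hsub)) ((Set.image_mono hsub).trans hps.image_subset)
  have h2 := hu x (q '' closure C) (hC.closure.image q (hq.mono hsub))
    (hcc.image_of_continuousOn (hq.mono hsub)) ((Set.image_mono hsub).trans hqu.image_subset)
  intro y hy z hz
  have hy' := subset_closure hy
  have hz' := subset_closure hz
  exact hpq y (hCB hy) z (hCB hz) (h1 ⟨y, hy', rfl⟩ ⟨z, hz', rfl⟩) (h2 ⟨y, hy', rfl⟩ ⟨z, hz', rfl⟩)

/-! ### Symbolic coding -/

namespace Homeomorph

variable {X : Type*} [TopologicalSpace X] (φ : X ≃ₜ X)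

theorem zpow_natCast_apply (n : ℕ) (x : X) : (φ ^ (n : ℤ)) x = φ^[n] x := by
  induction n with
  | zero => simp
  | succ n ih =>
    rw [Function.iterate_succ_apply', ← ih, ← mul_apply, ← zpow_one_add, Nat.cast_succ, add_comm]

theorem zpow_neg_natCast_apply (n : ℕ) (x : X) : (φ ^ (-n : ℤ)) x = φ.symm^[n] x := by
  rw [← zpow_natCast_apply, zpow_neg, ← inv_zpow]
  rfl

theorem zpow_apply_zpow_apply (k l : ℤ) (x : X) : (φ ^ k) ((φ ^ l) x) = (φ ^ (k + l)) x := by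
  rw [zpow_add, mul_apply]

theorem zpow_apply_apply (k : ℤ) (x : X) : (φ ^ k) (φ x) = (φ ^ (k + 1)) x := by
  rw [zpow_add_one, mul_apply]

end Homeomorph

/-- The word of length `l` read off the `P`-itinerary of `x`, starting at time `0`. -/
def itineraryWord {X A : Type*} [TopologicalSpace X] (φ : X ≃ₜ X) (P : X → A) (l : ℕ) (x : X) :
    Fin l → A :=
  fun j => P ((φ ^ (j : ℤ)) x)

section
variable {X : Type*} {A : Type} [TopologicalSpace X] (φ : X ≃ₜ X) (P : X → A)

theorem itineraryWord_comp_castSucc (l : ℕ) (x : X) :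
    itineraryWord φ P (l + 1) x ∘ Fin.castSucc = itineraryWord φ P l x :=
  rfl

theorem itineraryWord_comp_succ (l : ℕ) (x : X) :
    itineraryWord φ P (l + 1) x ∘ Fin.succ = itineraryWord φ P l (φ x) := by
  funext j
  change P ((φ ^ ((j.succ : ℕ) : ℤ)) x) = P ((φ ^ ((j : ℕ) : ℤ)) (φ x))
  rw [Homeomorph.zpow_apply_apply, Fin.val_succ, Nat.cast_succ]

/-- The higher block graph of the itineraries: its vertices are the words of length `l` which
occur, and its edges are the words of length `l + 1` which occur. -/
def wordGraph [Finite A] (l : ℕ) : FiniteGraph where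
  Vertex := Set.range (itineraryWord φ P l)
  Edge := Set.range (itineraryWord φ P (l + 1))
  i e := ⟨e.1 ∘ Fin.castSucc, by
    obtain ⟨x, hx⟩ := e.2
    exact ⟨x, by rw [← hx, itineraryWord_comp_castSucc]⟩⟩
  t e := ⟨e.1 ∘ Fin.succ, by
    obtain ⟨x, hx⟩ := e.2
    exact ⟨φ x, by rw [← hx, itineraryWord_comp_succ]⟩⟩
  no_source v := by
    obtain ⟨_, x, rfl⟩ := v
    refine ⟨⟨_, φ.symm x, rfl⟩, Subtype.ext ?_⟩
    change itineraryWord φ P (l + 1) _ ∘ Fin.succ = _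
    rw [itineraryWord_comp_succ, Homeomorph.apply_symm_apply]
  no_sink v := by
    obtain ⟨_, x, rfl⟩ := v
    exact ⟨⟨_, x, rfl⟩, rfl⟩

/-- The path in the higher block graph which codes the orbit of `x`. -/
def wordPath [Finite A] (l : ℕ) (x : X) : (wordGraph φ P l).PathSpace :=
  ⟨fun k => ⟨_, (φ ^ k) x, rfl⟩, fun k => Subtype.ext (by
    change itineraryWord φ P (l + 1) _ ∘ Fin.succ = itineraryWord φ P (l + 1) _ ∘ Fin.castSucc
    rw [itineraryWord_comp_succ, itineraryWord_comp_castSucc, ← Homeomorph.mul_apply,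
      ← zpow_one_add, add_comm])⟩

theorem wordPath_apply [Finite A] (l : ℕ) (x : X) :
    wordPath φ P l (φ x) = (wordGraph φ P l).shift (wordPath φ P l x) := by
  refine Subtype.ext (funext fun k => Subtype.ext ?_)
  change itineraryWord φ P (l + 1) _ = itineraryWord φ P (l + 1) _
  rw [Homeomorph.zpow_apply_apply]

variable {φ P}

theorem continuous_wordPath [Finite A] (hP : IsLocallyConstant P) (l : ℕ) :
    Continuous (wordPath φ P l) := by
  refine Continuous.subtype_mk (continuous_pi fun k => ?_) _
  refine IsLocallyConstant.continuous ((IsLocallyConstant.iff_eventually_eq _).2 fun x => ?_)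
  have : ∀ᶠ y in 𝓝 x, ∀ j : Fin (l + 1),
      P ((φ ^ (j : ℤ)) ((φ ^ k) y)) = P ((φ ^ (j : ℤ)) ((φ ^ k) x)) := by
    rw [eventually_all]
    intro j
    exact (((φ ^ (j : ℤ)).continuous.comp (φ ^ k).continuous).tendsto x).eventually
      ((IsLocallyConstant.iff_eventually_eq P).1 hP _)
  filter_upwards [this] with y hy
  exact Subtype.ext (funext hy)

/-- A sequence all of whose words of length `m + 2` occur in itineraries is an itinerary. Longer and
longer words of it are obtained by splicing, and compactness gives a point for the sequence. -/
theorem exists_itinerary_eq [CompactSpace X] (hP : IsLocallyConstant P) {m : ℕ}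
    (hsplice : ∀ x y, (∀ k : ℤ, 0 ≤ k → k ≤ m → P ((φ ^ k) x) = P ((φ ^ k) y)) →
      ∃ z, (∀ k : ℤ, 0 ≤ k → P ((φ ^ k) z) = P ((φ ^ k) x)) ∧
        ∀ k : ℤ, k ≤ m → P ((φ ^ k) z) = P ((φ ^ k) y))
    {a : ℤ → A}
    (ha : ∀ k, ∃ x, ∀ j : ℤ, 0 ≤ j → j ≤ m + 1 → P ((φ ^ j) x) = a (k + j)) :
    ∃ x, ∀ k, P ((φ ^ k) x) = a k := by
  have hlong : ∀ (n : ℕ) (k : ℤ),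
      ∃ x, ∀ j : ℤ, 0 ≤ j → j ≤ m + 1 + n → P ((φ ^ j) x) = a (k + j) := by
    intro n k
    induction n with
    | zero => simpa using ha k
    | succ n ih =>
      obtain ⟨y, hy⟩ := ih
      obtain ⟨z, hz⟩ := ha (k + n + 1)
      obtain ⟨w, hwz, hwy⟩ := hsplice z ((φ ^ (n + 1 : ℤ)) y) (by
        intro j h0 hj
        rw [Homeomorph.zpow_apply_zpow_apply, hz j h0 (by omega), hy _ (by omega) (by omega)]
        congr 1
        ring)
      refine ⟨(φ ^ (-(n + 1) : ℤ)) w, fun j h0 hj => ?_⟩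
      rw [Homeomorph.zpow_apply_zpow_apply]
      rcases le_total (j + -(n + 1 : ℤ)) m with hle | hge
      · rw [hwy _ hle, Homeomorph.zpow_apply_zpow_apply, neg_add_cancel_right]
        exact hy j h0 (by omega)
      · rw [hwz _ (by omega), hz _ (by omega) (by push_cast at hj; omega)]
        congr 1
        ring
  let T : ℕ → Set X := fun n => {x | ∀ k : ℤ, |k| ≤ n → P ((φ ^ k) x) = a k}
  have hTc : ∀ n, IsClosed (T n) := by
    intro n
    simp only [T, Set.ofPred_forall]
    refine isClosed_iInter fun k => isClosed_iInter fun _ => ?_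
    exact (hP.isClosed_fiber (a k)).preimage (φ ^ k).continuous
  obtain ⟨x, hx⟩ := IsCompact.nonempty_iInter_of_sequence_nonempty_isCompact_isClosed T
    (fun n x hx k hk => hx k (hk.trans (by push_cast; linarith)))
    (fun n => by
      obtain ⟨x, hx⟩ := hlong (2 * n) (-n)
      refine ⟨(φ ^ (n : ℤ)) x, fun k hk => ?_⟩
      rw [abs_le] at hk
      rw [Homeomorph.zpow_apply_zpow_apply, hx _ (by omega) (by push_cast; omega)]
      congr 1
      ring)
    (hTc 0).isCompact hTc
  exact ⟨x, fun k => Set.mem_iInter.1 hx k.natAbs k (by rw [Int.abs_eq_natAbs])⟩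

/-- A compact system with a locally constant generating coding by finitely many letters is a shift
of finite type if itineraries which agree on `[0, m]` can be spliced along that interval. -/
theorem isShiftOfFiniteType_of_splice [CompactSpace X] [Finite A] (hP : IsLocallyConstant P)
    (hinj : ∀ x y, (∀ k : ℤ, P ((φ ^ k) x) = P ((φ ^ k) y)) → x = y) {m : ℕ}
    (hsplice : ∀ x y, (∀ k : ℤ, 0 ≤ k → k ≤ m → P ((φ ^ k) x) = P ((φ ^ k) y)) →
      ∃ z, (∀ k : ℤ, 0 ≤ k → P ((φ ^ k) z) = P ((φ ^ k) x)) ∧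
        ∀ k : ℤ, k ≤ m → P ((φ ^ k) z) = P ((φ ^ k) y)) :
    IsShiftOfFiniteType φ := by
  have hbij : Function.Bijective (wordPath φ P (m + 1)) := by
    constructor
    · intro x y hxy
      refine hinj x y fun k => ?_
      have h1 := congrFun (congrArg Subtype.val (congrFun (congrArg Subtype.val hxy) k)) 0
      simpa [wordPath, itineraryWord] using h1
    · intro e
      let word : ℤ → Fin (m + 2) → A := fun k => (e.1 k).1
      have hstep : ∀ k (j : Fin (m + 1)), word k j.succ = word (k + 1) j.castSucc := fun k j =>
        congrFun (congrArg Subtype.val (e.2 k)) j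
      -- Consecutive words overlap, so all letters are first letters of later words.
      have hword : ∀ (j : ℕ) (hj : j < m + 2) (k : ℤ), word k ⟨j, hj⟩ = word (k + j) 0 := by
        intro j
        induction j with
        | zero => intro hj k; simp
        | succ j ih =>
          intro hj k
          have h1 := hstep k ⟨j, by omega⟩
          have h2 := ih (by omega) (k + 1)
          rw [show k + ((j + 1 : ℕ) : ℤ) = k + 1 + j by push_cast; ring, ← h2]
          exact h1
      obtain ⟨x, hx⟩ := exists_itinerary_eq hP hsplice (a := fun k => word k 0) (by
        intro k
        obtain ⟨x, hx⟩ := (e.1 k).2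
        refine ⟨x, fun j h0 hj => ?_⟩
        lift j to ℕ using h0
        rw [← hword j (by omega) k]
        exact congrFun hx ⟨j, by omega⟩)
      refine ⟨x, Subtype.ext (funext fun k => Subtype.ext (funext fun j => ?_))⟩
      change P ((φ ^ (j : ℤ)) ((φ ^ k) x)) = word k j
      rw [Homeomorph.zpow_apply_zpow_apply, hx, add_comm]
      exact (hword j j.2 k).symm
  exact ⟨wordGraph φ P (m + 1), (continuous_wordPath hP (m + 1)).homeoOfEquivCompactToT2
    (f := Equiv.ofBijective _ hbij), wordPath_apply φ P (m + 1)⟩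

end

/-- A finite partition into clopen sets of small diameter: the letter of a point records which
members of a finite clopen cover contain it. -/
theorem exists_isLocallyConstant_dist_le {X : Type*} [MetricSpace X] [CompactSpace X]
    [TotallyDisconnectedSpace X] {c : ℝ} (hc : 0 < c) :
    ∃ (n : ℕ) (P : X → Fin n → Prop), IsLocallyConstant P ∧ ∀ x y, P x = P y → dist x y ≤ c := by
  have hV : ∀ x : X, ∃ V, IsClopen V ∧ x ∈ V ∧ V ⊆ Metric.ball x (c / 2) := fun x =>
    compact_exists_isClopen_in_isOpen Metric.isOpen_ball (Metric.mem_ball_self (half_pos hc))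
  choose V hVc hxV hVb using hV
  obtain ⟨t, ht⟩ := isCompact_univ.elim_finite_subcover V (fun x => (hVc x).2)
    fun x _ => Set.mem_iUnion.2 ⟨x, hxV x⟩
  refine ⟨t.card, fun x j => x ∈ V (t.equivFin.symm j), ?_, fun x y hxy => ?_⟩
  · rw [IsLocallyConstant.iff_eventually_eq]
    intro x
    have : ∀ᶠ y in 𝓝 x, ∀ j : Fin t.card,
        y ∈ V (t.equivFin.symm j) ↔ x ∈ V (t.equivFin.symm j) := by
      rw [eventually_all]
      intro j
      by_cases hx : x ∈ V (t.equivFin.symm j)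
      · filter_upwards [(hVc _).2.mem_nhds hx] with y hy
        simp [hx, hy]
      · filter_upwards [(hVc _).1.isOpen_compl.mem_nhds hx] with y hy
        simp only [hx, iff_false]
        exact hy
    filter_upwards [this] with y hy
    exact funext fun j => propext (hy j)
  · obtain ⟨p, hp, hxp⟩ := Set.mem_iUnion₂.1 (ht (Set.mem_univ x))
    have hj := congrFun hxy (t.equivFin ⟨p, hp⟩)
    simp only [Equiv.symm_apply_apply, eq_iff_iff] at hj
    have h1 := hVb _ hxp
    have h2 := hVb _ (hj.1 hxp)
    rw [Metric.mem_ball] at h1 h2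
    exact (dist_triangle_right x y p).trans (by linarith)

/-- Uniform expansivity: points whose itineraries agree for a long time are close. -/
theorem exists_forall_dist_le_of_itinerary_eq {X A : Type*} [MetricSpace X] [CompactSpace X]
    {φ : X ≃ₜ X} {P : X → A} (hP : IsLocallyConstant P)
    (hinj : ∀ x y, (∀ k : ℤ, P ((φ ^ k) x) = P ((φ ^ k) y)) → x = y) {δ : ℝ} (hδ : 0 < δ) :
    ∃ N : ℕ, ∀ x y, (∀ k : ℤ, |k| ≤ N → P ((φ ^ k) x) = P ((φ ^ k) y)) → dist x y ≤ δ := by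
  by_contra! hcon
  let T : ℕ → Set (X × X) := fun n =>
    {p | (∀ k : ℤ, |k| ≤ n → P ((φ ^ k) p.1) = P ((φ ^ k) p.2)) ∧ δ ≤ dist p.1 p.2}
  have hTc : ∀ n, IsClosed (T n) := by
    intro n
    have hT : T n = (⋂ k : ℤ, ⋂ _ : |k| ≤ n, {p | P ((φ ^ k) p.1) = P ((φ ^ k) p.2)}) ∩
        {p | δ ≤ dist p.1 p.2} := by
      ext p
      simp [T]
    rw [hT]
    refine IsClosed.inter ?_ (isClosed_le continuous_const continuous_dist)
    refine isClosed_iInter fun k => isClosed_iInter fun _ => ?_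
    let : TopologicalSpace A := ⊥
    have : DiscreteTopology A := ⟨rfl⟩
    exact isClosed_eq (hP.continuous.comp ((φ ^ k).continuous.comp continuous_fst))
      (hP.continuous.comp ((φ ^ k).continuous.comp continuous_snd))
  obtain ⟨p, hp⟩ := IsCompact.nonempty_iInter_of_sequence_nonempty_isCompact_isClosed T
    (fun n p hp => ⟨fun k hk => hp.1 k (hk.trans (by push_cast; linarith)), hp.2⟩)
    (fun n => by
      obtain ⟨x, y, h1, h2⟩ := hcon n
      exact ⟨(x, y), h1, h2.le⟩)
    (hTc 0).isCompact hTc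
  have hmem := fun n => Set.mem_iInter.1 hp n
  have heq := hinj p.1 p.2 fun k => (hmem k.natAbs).1 k (by rw [Int.abs_eq_natAbs])
  have := (hmem 0).2
  rw [heq, dist_self] at this
  linarith

theorem IsSmaleSpace.isShiftOfFiniteType {X : Type*} [MetricSpace X] [CompactSpace X]
    [TotallyDisconnectedSpace X] {φ : X ≃ₜ X} (h : IsSmaleSpace φ) : IsShiftOfFiniteType φ := by
  obtain ⟨c, hc, hexp⟩ := h.exists_expansive
  obtain ⟨n, P, hP, hPc⟩ := exists_isLocallyConstant_dist_le (X := X) hc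
  have hinj : ∀ x y, (∀ k : ℤ, P ((φ ^ k) x) = P ((φ ^ k) y)) → x = y := by
    intro x y hxy
    refine hexp x y (fun j => hPc _ _ ?_) (fun j => hPc _ _ ?_)
    · simpa only [Homeomorph.zpow_natCast_apply] using hxy j
    · simpa only [Homeomorph.zpow_neg_natCast_apply] using hxy (-j)
  obtain ⟨η, hη, hPη⟩ : ∃ η, 0 < η ∧ ∀ x y, dist x y ≤ η → P x = P y := by
    obtain ⟨η, hη, H⟩ := lebesgue_number_lemma_of_metric (isCompact_univ (X := X))
      (c := fun a => P ⁻¹' {a}) (fun a => hP.isOpen_fiber a)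
      fun x _ => Set.mem_iUnion.2 ⟨P x, rfl⟩
    refine ⟨η / 2, half_pos hη, fun x y hxy => ?_⟩
    obtain ⟨a, ha⟩ := H x (Set.mem_univ x)
    have hx : P x = a := ha (Metric.mem_ball_self hη)
    have hy : P y = a := ha (by rw [Metric.mem_ball, dist_comm]; linarith)
    rw [hx, hy]
  obtain ⟨δ, hδ, hbr⟩ := h.exists_splice hη
  obtain ⟨N, hN⟩ := exists_forall_dist_le_of_itinerary_eq hP hinj hδ
  refine isShiftOfFiniteType_of_splice hP hinj (m := 2 * N) fun x y hxy => ?_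
  -- The bracket is taken at time `N`, the middle of the window on which the itineraries agree.
  obtain ⟨z, -, -, h1, h2⟩ := hbr ((φ ^ (N : ℤ)) x) ((φ ^ (N : ℤ)) y) (hN _ _ fun k hk => by
    rw [abs_le] at hk
    rw [Homeomorph.zpow_apply_zpow_apply, Homeomorph.zpow_apply_zpow_apply]
    exact hxy _ (by omega) (by push_cast; omega))
  have hzx : ∀ k : ℤ, N ≤ k → P ((φ ^ (k - N)) z) = P ((φ ^ k) x) := by
    intro k hk
    obtain ⟨j, rfl⟩ := Int.le.dest hk
    have := hPη _ _ (h1 j)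
    simp only [← Homeomorph.zpow_natCast_apply, Homeomorph.zpow_apply_zpow_apply] at this
    rw [add_sub_cancel_left, ← this, add_comm]
  have hzy : ∀ k : ℤ, k ≤ N → P ((φ ^ (k - N)) z) = P ((φ ^ k) y) := by
    intro k hk
    obtain ⟨j, hj⟩ := Int.le.dest hk
    have := hPη _ _ (h2 j)
    simp only [← Homeomorph.zpow_neg_natCast_apply, Homeomorph.zpow_apply_zpow_apply] at this
    rw [show k - N = -j by omega, ← this]
    congr 3
    omega
  refine ⟨(φ ^ (-N : ℤ)) z, fun k h0 => ?_, fun k hk => ?_⟩ <;>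
    rw [Homeomorph.zpow_apply_zpow_apply, ← sub_eq_add_neg]
  · rcases le_total (N : ℤ) k with hle | hge
    · exact hzx k hle
    · rw [hzy k hge, hxy k h0 (by push_cast; omega)]
  · rcases le_total (N : ℤ) k with hle | hge
    · rw [hzx k hle, hxy k (by omega) hk]
    · exact hzy k hge

theorem IsShiftOfFiniteType.totallyDisconnectedSpace {X : Type*} [TopologicalSpace X] {φ : X ≃ₜ X}
    (h : IsShiftOfFiniteType φ) : TotallyDisconnectedSpace X := by
  obtain ⟨G, e, -⟩ := h
  have : TotallyDisconnectedSpace G.PathSpace := inferInstance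
  exact e.symm.totallyDisconnectedSpace

/-! ### Correspondences in both directions -/

theorem mainTheorem12
    {X : Type u} [MetricSpace X] [CompactSpace X] (φ : X ≃ₜ X) (hφ : IsSmaleSpace φ)
    {S : Type v} [MetricSpace S] [CompactSpace S] (σ : S ≃ₜ S) (hσ : IsSmaleSpace σ)
    (hsft : IsShiftOfFiniteType σ)
    (hXS : Nonempty (Correspondence.{u, v, w₁} φ σ))
    (hSX : Nonempty (Correspondence.{v, u, w₂} σ φ)) :
    IsShiftOfFiniteType φ := by
  obtain ⟨m⟩ := hXS
  obtain ⟨n⟩ := hSX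
  have := hsft.totallyDisconnectedSpace
  let := m.metricSpace
  have := m.compactSpace
  let := n.metricSpace
  have := n.compactSpace
  have : TotallyDisconnectedSpace m.M :=
    m.isSBijective.totallyDisconnectedSpace m.isSmaleSpace hσ
  have : TotallyDisconnectedSpace n.M :=
    n.isUBijective.symm.totallyDisconnectedSpace n.isSmaleSpace.symm hσ.symm
  have : TotallyDisconnectedSpace X := hφ.totallyDisconnectedSpace
    (fun _ _ hC hCc hCx =>
      n.isSBijective.subsingleton_of_subset_stableSet n.isSmaleSpace hC hCc hCx)
    (fun _ _ hC hCc hCx =>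
      m.isUBijective.symm.subsingleton_of_subset_stableSet m.isSmaleSpace.symm hC hCc hCx)
  exact hφ.isShiftOfFiniteType
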